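/- **Theorem 2.1.** Let $W=\{0,1,\dots,5\}$, let $W_*=\bigcup_{n\ge0}W^n$ be the set of finite words (with $|w|=n$ for $w\in W^n$) and $W_\infty=W^{\mathbb N}$ the set of infinite words with the product topology. Let $\sim$ be the equivalence relation on $W_\infty$ generated by the following identifications, for all $w\in W_*$, $i\in W$, $j=i+1\ (\mathrm{mod}\ 6)$ and $v\in\{0,5\}^{\mathbb N}$: if $i$ is even, $wi1v\sim wj1v$ and $wi2v\sim wj2v$; if $i$ is odd, $wi3v\sim wj3v$ and $wi4v\sim wj4v$. The Strichartz hexacarpet is the quotient $K=W_\infty/\!\sim$, with quotient map $\pi$. For $i\in W$ let $f_i:K\to K$ be the map with $f_i(\pi(v))=\pi(iv)$ for all $v\in W_\infty$, and for $w=w_1\dots w_n\in W_*$ let $K_w=f_{w_1}\circ\dots\circ f_{w_n}(K)$ (an $n$-cell; $K_\emptyset=K$). Let $\mu\in(0,1)$. For $x,y\in K$ let $\mathcal C(x,y)$ be the set of finite sequences $(w^{(1)},\dots,w^{(m)})$, $m\ge1$, of words in $W_*$ such that $K_{w^{(k)}}\cap K_{w^{(k+1)}}\neq\emptyset$ for $1\le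 k<m$, $x\in K_{w^{(1)}}$ and $y\in K_{w^{(m)}}$, and let $$d_\mu(x,y)=\inf\Big\{\sum_{k=1}^m\mu^{|w^{(k)}|}:(w^{(1)},\dots,w^{(m)})\in\mathcal C(x,y)\Big\}.$$ Then $d_\mu$ is a metric on $K$ if and only if $\mu\in[1/2,1)$. Moreover, for every $\mu\in[1/2,1)$: 1. $d_\mu(f_i(x),f_i(y))=\mu\,d_\mu(x,y)$ for all $i\in W$ and $x,y\in K$; 2. $\sup\{d_\mu(x,y):x,y\in K_w\}=\mu^{|w|}$ for all $w\in W_*$; 3. the Hausdorff dimension of $(K,d_\mu)$ is $\alpha=-\log 6/\log\mu$, and the normalized Hausdorff measure of dimension $\alpha$ exists, that is, the $\alpha$-dimensional Hausdorff measure $\mathcal H^\alpha$ of $(K,d_\mu)$ satisfies $0<\mathcal H^\alpha(K)<\infty$, so that $\mathcal H^\alpha/\mathcal H^\alpha(K)$ is a Borel probability measure on $K$. -/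

import Mathlib

open MeasureTheory Set
open scoped ENNReal

namespace Strichartz

/-- The alphabet `W = {0, …, 5}`; addition in `Fin 6` is addition modulo `6`. -/
abbrev Letter : Type := Fin 6

/-- Finite words, the elements of `W_*`; `|w|` is `w.length`. -/
abbrev Word : Type := List Letter

/-- Infinite words, the elements of `W_∞`, with the product topology. -/
abbrev InfWord : Type := ℕ → Letter

/-- The shift `σ_i : w₁w₂… ↦ i w₁w₂…`. -/
def cons (i : Letter) (v : InfWord) : InfWord
  | 0 => i
  | n + 1 => v n

/-- The concatenation `w v` of a finite and an infinite word. -/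
def append : Word → InfWord → InfWord
  | [], v => v
  | i :: w, v => cons i (append w v)

/-- The elementary identifications: for `v ∈ {0,5}^∞` and `j = i + 1 (mod 6)`,
`w i k v` and `w j k v` are glued for `k = 1, 2` if `i` is even, for `k = 3, 4` if `i` is odd. -/
inductive Glue : InfWord → InfWord → Prop
  | even (w : Word) (i k : Letter) (v : InfWord) (hi : Even i.val) (hk : k = 1 ∨ k = 2)
      (hv : ∀ n, v n = 0 ∨ v n = 5) :
      Glue (append w (cons i (cons k v))) (append w (cons (i + 1) (cons k v)))
  | odd (w : Word) (i k : Letter) (v : InfWord) (hi : Odd i.val) (hk : k = 3 ∨ k = 4)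
      (hv : ∀ n, v n = 0 ∨ v n = 5) :
      Glue (append w (cons i (cons k v))) (append w (cons (i + 1) (cons k v)))

/-- The equivalence relation on `W_∞` generated by the elementary identifications. -/
def gluing : Setoid InfWord := Relation.EqvGen.setoid Glue

/-- The Strichartz hexacarpet `K = W_∞ / ∼`. -/
def Hexacarpet : Type := Quotient gluing

/-- The quotient topology on the hexacarpet. -/
instance : TopologicalSpace Hexacarpet := inferInstanceAs (TopologicalSpace (Quotient gluing))

/-- The quotient map `π : W_∞ → K`. -/
def proj (v : InfWord) : Hexacarpet := Quotient.mk gluing v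

theorem Glue.cons {u v : InfWord} (h : Glue u v) (a : Letter) :
    Glue (Strichartz.cons a u) (Strichartz.cons a v) := by
  cases h with
  | even w i k v hi hk hv => exact Glue.even (a :: w) i k v hi hk hv
  | odd w i k v hi hk hv => exact Glue.odd (a :: w) i k v hi hk hv

theorem gluing_cons (a : Letter) (u v : InfWord) (h : gluing u v) :
    gluing (cons a u) (cons a v) := by
  change Relation.EqvGen Glue u v at h
  change Relation.EqvGen Glue (cons a u) (cons a v)
  induction h with
  | rel x y h => exact .rel _ _ (h.cons a)
  | refl x => exact .refl _
  | symm x y _ ih => exact .symm _ _ ih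
  | trans x y z _ _ ih₁ ih₂ => exact .trans _ _ _ ih₁ ih₂

/-- The map `f_i : K → K` with `π ∘ σ_i = f_i ∘ π`. -/
def f (i : Letter) : Hexacarpet → Hexacarpet :=
  Quotient.map (cons i) (gluing_cons i)

theorem f_proj (i : Letter) (v : InfWord) : f i (proj v) = proj (cons i v) := rfl

/-- `f_w = f_{w₁} ∘ ⋯ ∘ f_{wₙ}`, with `f_∅ = id`. -/
def fWord : Word → Hexacarpet → Hexacarpet
  | [] => id
  | i :: w => f i ∘ fWord w

/-- The cell `K_w = f_w(K)`, an `n`-cell for `n = |w|`. -/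
def cell (w : Word) : Set Hexacarpet := range (fWord w)

/-- `c = {w⁽¹⁾, …, w⁽ᵐ⁾}` (with `m ≥ 1`) is a chain connecting `x` and `y`: consecutive cells
intersect, `x` lies in the first cell and `y` in the last one. -/
def IsChainConnecting (x y : Hexacarpet) (c : List Word) : Prop :=
  c.IsChain (fun u v => (cell u ∩ cell v).Nonempty) ∧
    (∃ u ∈ c.head?, x ∈ cell u) ∧ (∃ v ∈ c.getLast?, y ∈ cell v)

/-- The weight `∑ μ^{|w⁽ⁱ⁾|}` of a chain. -/
noncomputable def weight (μ : ℝ) (c : List Word) : ℝ := (c.map fun w => μ ^ w.length).sum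

/-- The chain pseudo-metric `d_μ` (for `0 < μ < 1`): the infimum of a set of positive reals, which
is nonempty since the one-word chain `{∅}` connects any two points. -/
noncomputable def chainDist (μ : ℝ) (x y : Hexacarpet) : ℝ :=
  sInf {r : ℝ | ∃ c : List Word, IsChainConnecting x y c ∧ r = weight μ c}

/-- The axioms of a metric. -/
structure IsMetric {X : Type*} (d : X → X → ℝ) : Prop where
  nonneg : ∀ x y, 0 ≤ d x y
  self : ∀ x, d x x = 0
  symm : ∀ x y, d x y = d y x
  triangle : ∀ x y z, d x y ≤ d x z + d z y
  eq_of_zero : ∀ x y, d x y = 0 → x = y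

/-- The metric space `(X, d)`, with the topology of the metric. -/
@[reducible] def IsMetric.toMetricSpace {X : Type*} {d : X → X → ℝ} (h : IsMetric d) :
    MetricSpace X where
  dist := d
  dist_self := h.self
  dist_comm := h.symm
  dist_triangle x y z := h.triangle x z y
  eq_of_dist_eq_zero := h.eq_of_zero _ _

/-- The Hausdorff dimension of the metric space `(X, d)`. -/
noncomputable def IsMetric.hausdorffDim {X : Type*} {d : X → X → ℝ} (h : IsMetric d) : ℝ≥0∞ :=
  letI : MetricSpace X := h.toMetricSpace
  dimH (univ : Set X)

/-- The Borel sets of the metric space `(X, d)`. -/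
@[reducible] def IsMetric.borel {X : Type*} {d : X → X → ℝ} (h : IsMetric d) :
    MeasurableSpace X :=
  letI : MetricSpace X := h.toMetricSpace
  _root_.borel X

/-- The `α`-dimensional Hausdorff measure of the metric space `(X, d)`. -/
noncomputable def IsMetric.hausdorffMeasure {X : Type*} {d : X → X → ℝ} (h : IsMetric d)
    (α : ℝ) : @Measure X h.borel :=
  letI : MetricSpace X := h.toMetricSpace
  letI : MeasurableSpace X := h.borel
  haveI : BorelSpace X := ⟨rfl⟩
  Measure.hausdorffMeasure α

/-- `H^α / H^α(X)`, where `H^α` is the `α`-dimensional Hausdorff measure of `(X, d)`; meaningful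
when `0 < H^α(X) < ∞`. -/
noncomputable def IsMetric.normalizedHausdorffMeasure {X : Type*} {d : X → X → ℝ}
    (h : IsMetric d) (α : ℝ) : @Measure X h.borel :=
  letI : MeasurableSpace X := h.borel
  (h.hausdorffMeasure α univ)⁻¹ • h.hausdorffMeasure α

end Strichartz

/-! Upper bounds on `chainDist` come from exhibiting chains. Lower bounds come from test functions:
by telescoping along a chain, a function whose oscillation on every cell `K_w` is at most `μ ^ |w|`
is 1-Lipschitz (`abs_sub_le_chainDist`). The scaling law holds because an elementary identification
changes a single letter, so the left shift descends to `K` and folds each 1-cell onto `K`; adding or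
deleting a first letter then transports chains (`chainDist_f`).

For `μ ≥ 1/2` the test functions are `sideDist` and `wordDist`, rescaled distances for the parameter
`1/2` computed by reading a word. They agree on glued words, and each further letter halves their
oscillation, hence reduces it at least by the factor `μ`. Consequently `d(x, y) < μ ^ n` forces `y`
into one of boundedly many level-`n` cells around `x` (`wordDist_pre_lt_one`, `exists_cover`). If
this happens at every level, `x = y` (`gluing_of_wordDist_lt_one`), so `d` is a metric. The distance
to a side also yields two points at distance 1, and with the scaling law the diameters of all cells.

For `μ < 1/2` the points `π(000…)` and `π(1000…)` are joined through two copies of the same pair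
scaled by `μ`. Thus `d ≤ 2μ d`, so `d = 0`, although the points differ.

For the dimension, the `6 ^ n` cells of level `n` have diameter at most `μ ^ n`, which bounds the
Hausdorff measure above; the bounded number of neighbours and the uniform Bernoulli measure bound it
below by the mass distribution principle. -/

namespace Strichartz

/-! ### The shift, cells and finite prefixes -/

/-- The left shift on infinite words. -/
def tail (v : InfWord) : InfWord := fun n => v (n + 1)

@[simp] theorem tail_cons (i : Letter) (v : InfWord) : tail (cons i v) = v := rfl

@[simp] theorem cons_zero (i : Letter) (v : InfWord) : cons i v 0 = i := rfl

theorem cons_head_tail (v : InfWord) : cons (v 0) (tail v) = v := by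
  funext n; cases n <;> rfl

theorem Glue.tail {u v : InfWord} (h : Glue u v) :
    Strichartz.tail u = Strichartz.tail v ∨ Glue (Strichartz.tail u) (Strichartz.tail v) := by
  cases h with
  | even w i k v hi hk hv =>
    cases w with
    | nil => exact .inl rfl
    | cons a w => exact .inr (Glue.even w i k v hi hk hv)
  | odd w i k v hi hk hv =>
    cases w with
    | nil => exact .inl rfl
    | cons a w => exact .inr (Glue.odd w i k v hi hk hv)

theorem gluing_tail (u v : InfWord) (h : gluing u v) : gluing (tail u) (tail v) := by
  change Relation.EqvGen Glue u v at h
  change Relation.EqvGen Glue (tail u) (tail v)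
  induction h with
  | rel x y h =>
    rcases h.tail with h | h
    · rw [h]; exact .refl _
    · exact .rel _ _ h
  | refl x => exact .refl _
  | symm x y _ ih => exact .symm _ _ ih
  | trans x y z _ _ ih₁ ih₂ => exact .trans _ _ _ ih₁ ih₂

/-- The map induced by the left shift; it folds every `1`-cell onto `K`. -/
def shift : Hexacarpet → Hexacarpet := Quotient.map tail gluing_tail

theorem shift_f (i : Letter) (x : Hexacarpet) : shift (f i x) = x := by
  induction x using Quotient.inductionOn; rfl

theorem proj_surjective : Function.Surjective proj := Quotient.mk_surjective

theorem proj_eq_iff {u v : InfWord} : proj u = proj v ↔ gluing u v := Quotient.eq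

theorem proj_eq_of_glue {u v : InfWord} (h : Glue u v) : proj u = proj v :=
  proj_eq_iff.2 (.rel _ _ h)

/-- A function on infinite words that respects the elementary identifications respects the
equivalence relation they generate. -/
theorem eq_of_gluing {α : Type*} {F : InfWord → α} (hF : ∀ u v, Glue u v → F u = F v)
    {u v : InfWord} (h : gluing u v) : F u = F v := by
  change Relation.EqvGen Glue u v at h
  induction h with
  | rel x y h => exact hF x y h
  | refl x => rfl
  | symm x y _ ih => exact ih.symm
  | trans x y z _ _ ih₁ ih₂ => exact ih₁.trans ih₂

theorem fWord_proj (w : Word) (v : InfWord) : fWord w (proj v) = proj (append w v) := by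
  induction w with
  | nil => rfl
  | cons a w ih => simp only [fWord, Function.comp, ih, f_proj, append]

theorem mem_cell {w : Word} {x : Hexacarpet} : x ∈ cell w ↔ ∃ v, proj (append w v) = x := by
  constructor
  · rintro ⟨y, rfl⟩
    obtain ⟨v, rfl⟩ := proj_surjective y
    exact ⟨v, (fWord_proj w v).symm⟩
  · rintro ⟨v, rfl⟩
    exact ⟨proj v, fWord_proj w v⟩

theorem f_mem_cell {i : Letter} {w : Word} {x : Hexacarpet} (h : x ∈ cell w) :
    f i x ∈ cell (i :: w) := by
  obtain ⟨y, rfl⟩ := h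
  exact ⟨y, rfl⟩

theorem shift_mem_cell {i : Letter} {w : Word} {x : Hexacarpet} (h : x ∈ cell (i :: w)) :
    shift x ∈ cell w := by
  obtain ⟨y, rfl⟩ := h
  exact ⟨y, (shift_f i _).symm⟩

theorem mem_cell_nil (x : Hexacarpet) : x ∈ cell [] := ⟨x, rfl⟩

/-- The word formed by the first `n` letters. -/
def pre : ℕ → InfWord → Word
  | 0, _ => []
  | n + 1, v => v 0 :: pre n (tail v)

@[simp] theorem length_pre (n : ℕ) (v : InfWord) : (pre n v).length = n := by
  induction n generalizing v with
  | zero => rfl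
  | succ n ih => simp [pre, ih]

theorem append_pre (n : ℕ) (v : InfWord) : ∃ u, append (pre n v) u = v := by
  induction n generalizing v with
  | zero => exact ⟨v, rfl⟩
  | succ n ih =>
    obtain ⟨u, hu⟩ := ih (tail v)
    exact ⟨u, by rw [pre, append, hu, cons_head_tail]⟩

theorem proj_mem_cell_pre (n : ℕ) (v : InfWord) : proj v ∈ cell (pre n v) := by
  obtain ⟨u, hu⟩ := append_pre n v
  exact mem_cell.2 ⟨u, by rw [hu]⟩

/-! ### The chain pseudo-metric and its scaling law -/

section chainDist

variable {μ : ℝ}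

theorem weight_nonneg (hμ0 : 0 < μ) (c : List Word) : 0 ≤ weight μ c := by
  refine List.sum_nonneg fun r hr => ?_
  obtain ⟨w, -, rfl⟩ := List.mem_map.1 hr
  positivity

theorem pow_length_le_weight (hμ0 : 0 < μ) {c : List Word} {w : Word} (h : w ∈ c) :
    μ ^ w.length ≤ weight μ c := by
  refine List.single_le_sum (l := c.map fun w => μ ^ w.length) (fun r hr => ?_) _
    (List.mem_map.2 ⟨w, h, rfl⟩)
  obtain ⟨w, -, rfl⟩ := List.mem_map.1 hr
  positivity

theorem isChainConnecting_singleton {x y : Hexacarpet} {w : Word} (hx : x ∈ cell w)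
    (hy : y ∈ cell w) : IsChainConnecting x y [w] :=
  ⟨by simp, ⟨w, by simp, hx⟩, ⟨w, by simp, hy⟩⟩

theorem IsChainConnecting.symm {x y : Hexacarpet} {c : List Word}
    (h : IsChainConnecting x y c) : IsChainConnecting y x c.reverse := by
  obtain ⟨hc, hx, hy⟩ := h
  refine ⟨?_, by simpa using hy, by simpa using hx⟩
  rw [List.isChain_reverse]
  exact hc.imp fun u v h => by rwa [inter_comm]

theorem IsChainConnecting.trans {x y z : Hexacarpet} {c c' : List Word}
    (h : IsChainConnecting x y c) (h' : IsChainConnecting y z c') :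
    IsChainConnecting x z (c ++ c') := by
  obtain ⟨hc, ⟨u, hu, hx⟩, v, hv, hy⟩ := h
  obtain ⟨hc', ⟨u', hu', hy'⟩, v', hv', hz⟩ := h'
  refine ⟨List.isChain_append.2 ⟨hc, hc', ?_⟩, ⟨u, ?_, hx⟩, ⟨v', ?_, hz⟩⟩
  · intro a ha b hb
    rw [Option.mem_def] at *
    rw [hv] at ha; rw [hu'] at hb
    cases ha; cases hb
    exact ⟨y, hy, hy'⟩
  · rw [Option.mem_def] at *; simp [hu]
  · rw [Option.mem_def] at *; simp [hv']

theorem IsChainConnecting.ne_nil {x y : Hexacarpet} {c : List Word}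
    (h : IsChainConnecting x y c) : c ≠ [] := by
  rintro rfl
  obtain ⟨-, ⟨u, hu, -⟩, -⟩ := h
  simp at hu

theorem chainDist_le_weight (hμ0 : 0 < μ) {x y : Hexacarpet} {c : List Word}
    (h : IsChainConnecting x y c) : chainDist μ x y ≤ weight μ c :=
  csInf_le ⟨0, by rintro _ ⟨c, -, rfl⟩; exact weight_nonneg hμ0 c⟩ ⟨c, h, rfl⟩

theorem le_chainDist {x y : Hexacarpet} {r : ℝ}
    (h : ∀ c, IsChainConnecting x y c → r ≤ weight μ c) : r ≤ chainDist μ x y := by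
  refine le_csInf ⟨_, [[]], isChainConnecting_singleton (mem_cell_nil x) (mem_cell_nil y), rfl⟩ ?_
  rintro _ ⟨c, hc, rfl⟩
  exact h c hc

theorem chainDist_nonneg (hμ0 : 0 < μ) (x y : Hexacarpet) : 0 ≤ chainDist μ x y :=
  le_chainDist fun c _ => weight_nonneg hμ0 c

theorem chainDist_le_pow (hμ0 : 0 < μ) {x y : Hexacarpet} {w : Word} (hx : x ∈ cell w)
    (hy : y ∈ cell w) : chainDist μ x y ≤ μ ^ w.length := by
  simpa [weight] using chainDist_le_weight hμ0 (isChainConnecting_singleton hx hy)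

theorem chainDist_le_one (hμ0 : 0 < μ) (x y : Hexacarpet) : chainDist μ x y ≤ 1 := by
  simpa using chainDist_le_pow hμ0 (mem_cell_nil x) (mem_cell_nil y)

theorem chainDist_self (hμ0 : 0 < μ) (hμ1 : μ < 1) (x : Hexacarpet) : chainDist μ x x = 0 := by
  obtain ⟨v, rfl⟩ := proj_surjective x
  refine le_antisymm ?_ (chainDist_nonneg hμ0 _ _)
  refine ge_of_tendsto' (tendsto_pow_atTop_nhds_zero_of_lt_one hμ0.le hμ1) fun n => ?_
  simpa using chainDist_le_pow hμ0 (proj_mem_cell_pre n v) (proj_mem_cell_pre n v)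

theorem chainDist_comm (hμ0 : 0 < μ) (x y : Hexacarpet) : chainDist μ x y = chainDist μ y x := by
  have key : ∀ x y, chainDist μ x y ≤ chainDist μ y x := fun x y =>
    le_chainDist fun c hc => (chainDist_le_weight hμ0 hc.symm).trans_eq <| by
      simp [weight, List.map_reverse, List.sum_reverse]
  exact le_antisymm (key x y) (key y x)

theorem chainDist_triangle (hμ0 : 0 < μ) (x y z : Hexacarpet) :
    chainDist μ x y ≤ chainDist μ x z + chainDist μ z y := by
  rw [← sub_le_iff_le_add]
  refine le_chainDist fun c hc => ?_
  rw [sub_le_iff_le_add, ← sub_le_iff_le_add']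
  refine le_chainDist fun c' hc' => ?_
  rw [sub_le_iff_le_add']
  simpa [weight] using chainDist_le_weight hμ0 (hc.trans hc')

theorem weight_map_cons (i : Letter) (c : List Word) :
    weight μ (c.map (List.cons i)) = μ * weight μ c := by
  induction c with
  | nil => simp [weight]
  | cons w c ih =>
    simp only [weight, List.map_cons, List.sum_cons, List.length_cons] at ih ⊢
    rw [ih]; ring

theorem IsChainConnecting.map_cons {x y : Hexacarpet} {c : List Word}
    (h : IsChainConnecting x y c) (i : Letter) :
    IsChainConnecting (f i x) (f i y) (c.map (List.cons i)) := by
  obtain ⟨hc, ⟨u, hu, hx⟩, v, hv, hy⟩ := h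
  rw [Option.mem_def] at hu hv
  refine ⟨(List.isChain_map _).2 (hc.imp ?_), ⟨i :: u, by simp [hu], f_mem_cell hx⟩,
    ⟨i :: v, by simp [hv], f_mem_cell hy⟩⟩
  rintro a b ⟨z, ha, hb⟩
  exact ⟨f i z, f_mem_cell ha, f_mem_cell hb⟩

/-- Folding by the shift sends `K_{aw}` into `K_w` and preserves intersections. The empty word is
excluded because it has no first letter to lose, so its weight would not scale. -/
theorem IsChainConnecting.map_tail {x y : Hexacarpet} {c : List Word}
    (h : IsChainConnecting x y c) (hnil : [] ∉ c) :
    IsChainConnecting (shift x) (shift y) (c.map List.tail) := by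
  have key : ∀ {w z}, w ∈ c → z ∈ cell w → shift z ∈ cell w.tail := by
    rintro (_ | ⟨a, w⟩) z hw hz
    · exact absurd hw hnil
    · exact shift_mem_cell hz
  obtain ⟨hc, ⟨u, hu, hx⟩, v, hv, hy⟩ := h
  have hu' := List.mem_of_mem_head? hu
  have hv' := List.mem_of_mem_getLast? hv
  rw [Option.mem_def] at hu hv
  refine ⟨(List.isChain_map _).2 (hc.imp_of_mem_imp ?_), ⟨u.tail, by simp [hu], key hu' hx⟩,
    ⟨v.tail, by simp [hv], key hv' hy⟩⟩
  rintro a b ha hb ⟨z, hza, hzb⟩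
  exact ⟨shift z, key ha hza, key hb hzb⟩

theorem weight_map_tail {c : List Word} (hnil : [] ∉ c) :
    weight μ c = μ * weight μ (c.map List.tail) := by
  induction c with
  | nil => simp [weight]
  | cons w c ih =>
    rw [List.mem_cons, not_or] at hnil
    obtain ⟨a, w, rfl⟩ := List.exists_cons_of_ne_nil (Ne.symm hnil.1)
    have := ih hnil.2
    simp only [weight, List.map_cons, List.sum_cons, List.length_cons, List.tail_cons] at this ⊢
    rw [this]; ring

theorem chainDist_f (hμ0 : 0 < μ) (hμ1 : μ < 1) (i : Letter) (x y : Hexacarpet) :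
    chainDist μ (f i x) (f i y) = μ * chainDist μ x y := by
  apply le_antisymm
  · rw [← div_le_iff₀' hμ0]
    refine le_chainDist fun c hc => ?_
    rw [div_le_iff₀' hμ0, ← weight_map_cons i]
    exact chainDist_le_weight hμ0 (hc.map_cons i)
  · refine le_chainDist fun c hc => ?_
    -- A chain using the cell `K` itself already costs at least 1, and `μ * d ≤ 1`; every other
    -- chain can be folded.
    by_cases hnil : [] ∈ c
    · have h1 : (1 : ℝ) ≤ weight μ c := by simpa using pow_length_le_weight hμ0 hnil
      nlinarith [chainDist_le_one hμ0 x y]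
    · rw [weight_map_tail hnil]
      have := hc.map_tail hnil
      rw [shift_f, shift_f] at this
      exact mul_le_mul_of_nonneg_left (chainDist_le_weight hμ0 this) hμ0.le

theorem chainDist_fWord (hμ0 : 0 < μ) (hμ1 : μ < 1) (w : Word) (x y : Hexacarpet) :
    chainDist μ (fWord w x) (fWord w y) = μ ^ w.length * chainDist μ x y := by
  induction w with
  | nil => simp [fWord]
  | cons a w ih =>
    simp only [fWord, Function.comp, chainDist_f hμ0 hμ1, ih, List.length_cons]
    ring

/-- A function whose oscillation on every cell is at most the weight of the cell is `1`-Lipschitz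
with respect to the chain pseudo-metric. -/
theorem abs_sub_le_chainDist {F : Hexacarpet → ℝ}
    (hF : ∀ w, ∀ x ∈ cell w, ∀ y ∈ cell w, |F x - F y| ≤ μ ^ w.length) (x y : Hexacarpet) :
    |F x - F y| ≤ chainDist μ x y := by
  refine le_chainDist fun c hc => ?_
  induction c generalizing x with
  | nil => exact absurd rfl hc.ne_nil
  | cons w c ih =>
    obtain ⟨hc, ⟨u, hu, hx⟩, v, hv, hy⟩ := hc
    obtain rfl : w = u := by simpa using hu
    cases c with
    | nil =>
      obtain rfl : w = v := by simpa using hv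
      simpa [weight] using hF w x hx y hy
    | cons w' c =>
      rw [List.isChain_cons_cons] at hc
      obtain ⟨⟨z, hz, hz'⟩, hc⟩ := hc
      have h1 := ih z ⟨hc, ⟨w', by simp, hz'⟩, v, by simpa using hv, hy⟩
      have h2 := hF w x hx z hz
      have h3 : weight μ (w :: w' :: c) = μ ^ w.length + weight μ (w' :: c) := by simp [weight]
      rw [h3]
      exact (abs_sub_le _ _ _).trans (add_le_add h2 h1)

end chainDist

/-! ### Sides of cells and the distance to a side -/

/-- The three sides of a cell: the outer side `0` and the two sides `1`, `2` along which the cell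
is glued to its siblings. -/
abbrev Side : Type := Fin 3

/-- The side of `K` that the `1`-cell of a letter meets. -/
def side : Letter → Side := ![0, 1, 1, 2, 2, 0]

/-- The side along which the distinct `1`-cells `i` and `j` are glued, if they are. -/
def join (i j : Letter) : Option Side :=
  if j = i + 1 then (if Even i.val then some 1 else some 2)
  else if i = j + 1 then (if Even j.val then some 1 else some 2) else none

/-- The infinite words that represent the points on a side. -/
def OnSide (S : Side) (v : InfWord) : Prop := side (v 0) = S ∧ ∀ n, side (v (n + 1)) = 0

theorem side_eq_zero {a : Letter} : side a = 0 ↔ a = 0 ∨ a = 5 := by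
  revert a; decide

theorem OnSide.tail {S : Side} {v : InfWord} (h : OnSide S v) : OnSide 0 (tail v) :=
  ⟨h.2 0, fun n => h.2 (n + 1)⟩

theorem onSide_cons {S : Side} {k : Letter} {v : InfWord} (hk : side k = S)
    (hv : ∀ n, v n = 0 ∨ v n = 5) : OnSide S (cons k v) :=
  ⟨hk, fun n => side_eq_zero.2 (hv n)⟩

/-- Puts both kinds of gluing in one form, two siblings sharing the points of a common side, so that
compatibility of a recursively defined function reduces to a finite check on letters. -/
theorem Glue.induction_onSide {P : InfWord → InfWord → Prop}
    (base : ∀ i j S x, join i j = some S → OnSide S x →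
      P (Strichartz.cons i x) (Strichartz.cons j x))
    (step : ∀ a u v, Glue u v → P u v → P (Strichartz.cons a u) (Strichartz.cons a v))
    {u v : InfWord} (h : Glue u v) : P u v := by
  cases h with
  | even w i k v hi hk hv =>
    induction w with
    | nil =>
      exact base _ _ 1 _ (by simp [join, hi]) (onSide_cons (by revert hk; revert k; decide) hv)
    | cons a w ih => exact step _ _ _ (.even w i k v hi hk hv) ih
  | odd w i k v hi hk hv =>
    induction w with
    | nil =>
      exact base _ _ 2 _ (by simp [join, Nat.not_even_iff_odd.2 hi])
        (onSide_cons (by revert hk; revert k; decide) hv)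
    | cons a w ih => exact step _ _ _ (.odd w i k v hi hk hv) ih

theorem join_comm : ∀ i j, join i j = join j i := by decide

theorem gluing_of_join {i j : Letter} {S : Side} {v : InfWord} (h : join i j = some S)
    (hv : OnSide S v) : gluing (cons i v) (cons j v) := by
  have key : ∀ i, join i (i + 1) = some S → gluing (cons i v) (cons (i + 1) v) := by
    intro i h
    have hv' : ∀ n, tail v n = 0 ∨ tail v n = 5 := fun n => side_eq_zero.1 (hv.2 n)
    have h0 := hv.1
    rw [← cons_head_tail v]
    generalize v 0 = k at h0 ⊢
    rw [← h0] at h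
    refine .rel _ _ ?_
    by_cases hi : Even i.val
    · exact Glue.even [] i k _ hi (by clear h0; revert h hi; revert i k; decide) hv'
    · rw [Nat.not_even_iff_odd] at hi
      exact Glue.odd [] i k _ hi (by clear h0; revert h hi; revert i k; decide) hv'
  have hij : j = i + 1 ∨ i = j + 1 := by clear key hv; revert h; revert i j S; decide
  rcases hij with rfl | rfl
  · exact key i h
  · rw [join_comm] at h
    exact gluing.symm' (key j h)

/-- The sibling with which a `1`-cell is glued along the side `1`. -/
def flip : Letter → Letter := ![1, 0, 3, 2, 5, 4]

/-- Digits of the distance to a side, see `sideDigits`. -/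
def sideBit (s : Option Side) (a : Letter) : Fin 2 := if s = some (side a) then 0 else 1

/-- Transitions of the automaton that computes the distance to a side, see `sideDigits`. -/
def sideNext (s : Option Side) (a : Letter) : Option Side :=
  if s = some (side a) then some 0 else if s = some (side (flip a)) then some 1 else none

/-- The binary digits of `sideDist`, computed by an automaton that reads an infinite word. -/
def sideDigits : Option Side → InfWord → ℕ → Fin 2
  | s, v, 0 => sideBit s (v 0)
  | s, v, n + 1 => sideDigits (sideNext s (v 0)) (tail v) n

/-- The distance to a side for `μ = 1 / 2`, cut off at `1`; it is constant for the state
`none`. -/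
noncomputable def sideDist (s : Option Side) (v : InfWord) : ℝ := Real.ofDigits (sideDigits s v)

theorem sideDist_nonneg (s : Option Side) (v : InfWord) : 0 ≤ sideDist s v :=
  Real.ofDigits_nonneg _

theorem sideDist_le_one (s : Option Side) (v : InfWord) : sideDist s v ≤ 1 :=
  Real.ofDigits_le_one _

/-- Self-similarity at ratio `1/2`. In a 1-cell meeting the side, the value is half the distance to
its own outer side; in the sibling beyond it, `1/2` plus half the distance to the side `1` they
share. Elsewhere the state is `none`, which emits the digit 1 forever. -/
theorem sideDist_cons (s : Option Side) (a : Letter) (v : InfWord) :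
    sideDist s (cons a v) = ((sideBit s a : ℕ) + sideDist (sideNext s a) v) / 2 := by
  rw [sideDist, Real.ofDigits_eq_sum_add_ofDigits _ 1]
  simp only [Finset.sum_range_one, Real.ofDigitsTerm]
  have : (fun i => sideDigits s (cons a v) (i + 1)) = sideDigits (sideNext s a) v := rfl
  rw [this, ← sideDist]
  simp only [sideDigits, cons_zero]
  norm_num
  ring

theorem sideDist_approx (n : ℕ) {S : Side} {v : InfWord} (hv : OnSide S v) (s : Option Side) :
    |sideDist s v - if s = some S then 0 else 1| ≤ (1 / 2) ^ n := by
  induction n generalizing S v s with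
  | zero =>
    have h0 := sideDist_nonneg s v
    have h1 := sideDist_le_one s v
    rw [abs_le]
    split_ifs <;> constructor <;> norm_num <;> linarith
  | succ n ih =>
    have h := ih hv.tail (sideNext s (v 0))
    have h0 := hv.1
    rw [← cons_head_tail v, sideDist_cons]
    -- The expected 0/1 values satisfy the same recursion as `sideDist`, so the error halves with
    -- each letter.
    have key : ∀ (s : Option Side) (a : Letter), (if s = some (side a) then 0 else 1 : ℕ) * 2 =
        (sideBit s a : ℕ) + if sideNext s a = some 0 then 0 else 1 := by decide
    have key' : (if s = some S then 0 else 1 : ℝ) * 2 =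
        ((sideBit s (v 0) : ℕ) : ℝ) + if sideNext s (v 0) = some 0 then 0 else 1 := by
      rw [← h0]; exact_mod_cast key s (v 0)
    have e : ((sideBit s (v 0) : ℕ) + sideDist (sideNext s (v 0)) (tail v)) / 2 -
        (if s = some S then 0 else 1 : ℝ) = (sideDist (sideNext s (v 0)) (tail v) -
          if sideNext s (v 0) = some 0 then 0 else 1) / 2 := by linarith
    rw [e, abs_div, pow_succ, abs_two]
    linarith

theorem sideDist_of_onSide {S : Side} {v : InfWord} (hv : OnSide S v) (s : Option Side) :
    sideDist s v = if s = some S then 0 else 1 := by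
  have := ge_of_tendsto' (tendsto_pow_atTop_nhds_zero_of_lt_one (r := (1 / 2 : ℝ)) (by norm_num)
    (by norm_num)) fun n => sideDist_approx n hv s
  exact sub_eq_zero.1 (abs_nonpos_iff.1 this)

theorem sideDist_cons_eq {i j : Letter} {S : Side} {x : InfWord} (hS : join i j = some S)
    (hx : OnSide S x) (s : Option Side) : sideDist s (cons i x) = sideDist s (cons j x) := by
  simp only [sideDist_cons, sideDist_of_onSide hx]
  have key : ∀ (s : Option Side) (i j : Letter) (S : Side), join i j = some S →
      ((sideBit s i : ℕ) + if sideNext s i = some S then 0 else 1) =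
      (sideBit s j : ℕ) + if sideNext s j = some S then 0 else 1 := by decide
  congr 1
  exact_mod_cast key s i j S hS

theorem sideDist_glue {u v : InfWord} (h : Glue u v) (s : Option Side) :
    sideDist s u = sideDist s v := by
  revert s
  refine h.induction_onSide (P := fun u v => ∀ s, sideDist s u = sideDist s v)
    (fun i j S x hS hx => sideDist_cons_eq hS hx) fun a u v hg ih s => by
      simp only [sideDist_cons, ih]

theorem sideDist_append (u : Word) (s : Option Side) (x y : InfWord) :
    |sideDist s (append u x) - sideDist s (append u y)| ≤ (1 / 2) ^ u.length := by
  induction u generalizing s with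
  | nil =>
    have h0 := sideDist_nonneg s
    have h1 := sideDist_le_one s
    simpa [append] using abs_sub_le_of_le_of_le (h0 x) (h1 x) (h0 y) (h1 y)
  | cons a u ih =>
    simp only [append, sideDist_cons, List.length_cons, pow_succ]
    rw [← sub_div, add_sub_add_left_eq_sub, abs_div, abs_two]
    linarith [ih (sideNext s a)]

/-! ### The distance to a cell -/

/-- The distance, for `μ = 1 / 2` and rescaled, to the cell of `w` from points behind the side `s`,
after reflection in that side. -/
noncomputable def mirrorDist : Option Side → Word → InfWord → ℝ
  | s, [], v => sideDist s v
  | s, k :: w, v => if v 0 = k ∧ s = some (side k) then mirrorDist (some 0) w (tail v) else 1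

/-- A function that is `0` on the cell of `w`, is `1` off the neighbouring cells of the same level,
and equals the rescaled distance to the common side on each neighbouring cell. -/
noncomputable def wordDist : Word → InfWord → ℝ
  | [], _ => 0
  | a :: w, v => if v 0 = a then wordDist w (tail v) else mirrorDist (join a (v 0)) w (tail v)

theorem mirrorDist_cons_cons (s : Option Side) (k : Letter) (w : Word) (a : Letter) (v : InfWord) :
    mirrorDist s (k :: w) (cons a v) =
      if a = k ∧ s = some (side k) then mirrorDist (some 0) w v else 1 := rfl

theorem wordDist_cons_cons (k : Letter) (w : Word) (a : Letter) (v : InfWord) :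
    wordDist (k :: w) (cons a v) =
      if a = k then wordDist w v else mirrorDist (join k a) w v := rfl

theorem mirrorDist_mem_Icc (s : Option Side) (w : Word) (v : InfWord) :
    mirrorDist s w v ∈ Icc (0 : ℝ) 1 := by
  induction w generalizing s v with
  | nil => exact ⟨sideDist_nonneg s v, sideDist_le_one s v⟩
  | cons k w ih =>
    rw [mirrorDist]
    split_ifs
    · exact ih _ _
    · simp

theorem wordDist_mem_Icc (w : Word) (v : InfWord) : wordDist w v ∈ Icc (0 : ℝ) 1 := by
  induction w generalizing v with
  | nil => simp [wordDist]
  | cons k w ih =>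
    rw [wordDist]
    split_ifs
    · exact ih _
    · exact mirrorDist_mem_Icc _ _ _

theorem mirrorDist_of_onSide {S : Side} {v : InfWord} (hv : OnSide S v) {s : Option Side}
    (hs : s ≠ some S) (w : Word) : mirrorDist s w v = 1 := by
  cases w with
  | nil => rw [mirrorDist, sideDist_of_onSide hv, if_neg hs]
  | cons k w =>
    rw [mirrorDist, if_neg]
    rintro ⟨rfl, h⟩
    rw [hv.1] at h
    exact hs h

theorem join_ne_zero : ∀ i j, join i j ≠ some 0 := by decide

theorem join_self : ∀ i, join i i = none := by decide

theorem eq_of_join_eq : ∀ a i j S, join i j = some S → join a i = some S → a = j := by decide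

/-- Points of the mirror are fixed by the reflection. This is what makes `wordDist` match across a
common side. -/
theorem mirrorDist_eq_wordDist {S : Side} {v : InfWord} (hv : OnSide S v) (w : Word) :
    mirrorDist (some S) w v = wordDist w v := by
  induction w generalizing S v with
  | nil => rw [mirrorDist, sideDist_of_onSide hv, if_pos rfl, wordDist]
  | cons k w ih =>
    rw [mirrorDist, wordDist]
    by_cases h : v 0 = k
    · rw [if_pos h, if_pos ⟨h, by rw [← h, hv.1]⟩, ih hv.tail]
    · rw [if_neg h, if_neg fun h' => h h'.1, mirrorDist_of_onSide hv.tail (join_ne_zero _ _)]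

theorem mirrorDist_glue {u v : InfWord} (h : Glue u v) (s : Option Side) (w : Word) :
    mirrorDist s w u = mirrorDist s w v := by
  revert s w
  refine h.induction_onSide (P := fun u v => ∀ s w, mirrorDist s w u = mirrorDist s w v)
    (fun i j S x hS hx s w => ?_) fun a u v hg ih s w => ?_
  · cases w with
    | nil => exact sideDist_cons_eq hS hx s
    | cons k w =>
      have h0 : some (0 : Side) ≠ some S := fun h => join_ne_zero i j (by rw [hS, h])
      simp only [mirrorDist_cons_cons, mirrorDist_of_onSide hx h0, ite_self]
  · cases w with
    | nil =>
      have := ih (sideNext s a) []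
      simp only [mirrorDist] at this
      simp only [mirrorDist, sideDist_cons, this]
    | cons k w => simp only [mirrorDist_cons_cons, ih]

theorem wordDist_glue {u v : InfWord} (h : Glue u v) (w : Word) :
    wordDist w u = wordDist w v := by
  revert w
  refine Glue.induction_onSide (P := fun u v => ∀ w, wordDist w u = wordDist w v)
    (fun i j S x hS hx w => ?_) (fun a u v hg ih w => ?_) h
  · cases w with
    | nil => rfl
    | cons a w =>
      simp only [wordDist_cons_cons]
      by_cases hi : i = a
      · have hj : j ≠ a := by rintro rfl; rw [hi, join_self] at hS; cases hS
        rw [if_pos hi, if_neg hj, ← hi, hS, mirrorDist_eq_wordDist hx]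
      · rw [if_neg hi]
        by_cases hj : j = a
        · rw [if_pos hj, ← hj, join_comm, hS, mirrorDist_eq_wordDist hx]
        -- A 1-cell has a single neighbour through each side, so the side shared by `i` and `j` is
        -- not one by which either of them touches the third cell `a`; both values are 1.
        · rw [if_neg hj, mirrorDist_of_onSide hx fun h => hj (eq_of_join_eq _ _ _ _ hS h).symm,
            mirrorDist_of_onSide hx fun h =>
              hi (eq_of_join_eq _ _ _ _ (by rw [join_comm, hS]) h).symm]
  · cases w with
    | nil => rfl
    | cons b w => simp only [wordDist_cons_cons, ih, fun s => mirrorDist_glue hg s w]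

theorem mirrorDist_append {u w : Word} (h : w.length ≤ u.length) (s : Option Side)
    (x y : InfWord) :
    |mirrorDist s w (append u x) - mirrorDist s w (append u y)| ≤
      (1 / 2) ^ (u.length - w.length) := by
  induction w generalizing u s with
  | nil => exact sideDist_append u s x y
  | cons k w ih =>
    cases u with
    | nil => simp at h
    | cons a u =>
      simp only [append, mirrorDist_cons_cons]
      split_ifs
      · simpa using ih (by simpa using h) (some 0)
      · simp

theorem wordDist_append {u w : Word} (h : w.length ≤ u.length) (x y : InfWord) :
    |wordDist w (append u x) - wordDist w (append u y)| ≤ (1 / 2) ^ (u.length - w.length) := by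
  induction w generalizing u with
  | nil => simp [wordDist]
  | cons k w ih =>
    cases u with
    | nil => simp at h
    | cons a u =>
      have h' : w.length ≤ u.length := by simpa using h
      simp only [append, wordDist_cons_cons]
      split_ifs
      · simpa using ih h'
      · simpa using mirrorDist_append h' (join k a) x y

/-! ### Cells that are not separated from a given cell -/

theorem wordDist_pre (n : ℕ) (v : InfWord) : wordDist (pre n v) v = 0 := by
  induction n generalizing v with
  | zero => rfl
  | succ n ih => simp only [pre, wordDist, if_true, ih]

/-- Across a side, the only cell not separated from a given one is its mirror image, and then both
touch the mirror: the first letter lies on `s` and all later ones on the outer side. -/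
theorem pre_eq_of_mirrorDist_lt_one {s : Option Side} {k : Letter} {w : Word} {v : InfWord}
    (h : mirrorDist s (k :: w) v < 1) :
    pre (w.length + 1) v = k :: w ∧ s = some (side k) ∧ ∀ a ∈ w, side a = 0 := by
  induction w generalizing s k v with
  | nil =>
    rw [mirrorDist] at h
    split_ifs at h with h1
    · simpa [pre] using h1
    · simp at h
  | cons b w ih =>
    rw [mirrorDist] at h
    split_ifs at h with h1
    · obtain ⟨h2, h3, h4⟩ := ih h
      refine ⟨?_, h1.2, ?_⟩
      · rw [pre, List.length_cons, h2, h1.1]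
      · intro a ha
        rcases List.mem_cons.1 ha with rfl | ha
        · exact (Option.some.inj h3).symm
        · exact h4 a ha
    · simp at h

theorem apply_eq_of_pre_eq {u v : InfWord} {n m : ℕ} (hm : m < n) (h : pre n u = pre n v) :
    u m = v m := by
  induction n generalizing u v m with
  | zero => omega
  | succ n ih =>
    simp only [pre, List.cons.injEq] at h
    cases m with
    | zero => exact h.1
    | succ m => exact ih (u := tail u) (v := tail v) (by omega) h.2

theorem apply_mem_pre {v : InfWord} {n m : ℕ} (hm : m < n) : v m ∈ pre n v := by
  induction n generalizing v m with
  | zero => omega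
  | succ n ih =>
    cases m with
    | zero => simp [pre]
    | succ m => exact List.mem_cons_of_mem _ (ih (v := tail v) (by omega))

/-- With different first letters, `v` must mirror `u` at every level. Hence the tails coincide and
lie on the common side, which is an elementary identification. -/
theorem gluing_of_head_ne {u v : InfWord} (h : ∀ n, wordDist (pre n u) v < 1)
    (h0 : u 0 ≠ v 0) : gluing u v := by
  have key := fun n => pre_eq_of_mirrorDist_lt_one (s := join (u 0) (v 0)) (k := tail u 0)
    (w := pre n (tail (tail u))) (v := tail v) (by
      have := h (n + 2)
      rwa [pre, wordDist, if_neg (Ne.symm h0)] at this)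
  have htail : tail u = tail v := by
    funext n
    have h1 := (key n).1
    rw [length_pre] at h1
    exact (apply_eq_of_pre_eq (n := n + 1) (v := tail u) (by omega) h1).symm
  have hside : OnSide (side (tail u 0)) (tail u) :=
    ⟨rfl, fun n => (key (n + 1)).2.2 _ (apply_mem_pre (v := tail (tail u)) (by omega))⟩
  have := gluing_of_join (key 0).2.1 hside
  rwa [cons_head_tail, htail, cons_head_tail] at this

/-- If no cell of any level around `u` is separated from `v`, then `u` and `v` are glued. -/
theorem gluing_of_wordDist_lt_one {u v : InfWord} (h : ∀ n, wordDist (pre n u) v < 1) :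
    gluing u v := by
  by_cases huv : u = v
  · exact huv ▸ gluing.refl' u
  obtain ⟨m, hm⟩ := Function.ne_iff.1 huv
  clear huv
  by_cases h0 : u 0 = v 0
  -- Induction on a position where the words differ strips their common prefix.
  · induction m generalizing u v with
    | zero => exact absurd h0 hm
    | succ m ih =>
      have ht : ∀ n, wordDist (pre n (tail u)) (tail v) < 1 := fun n => by
        have := h (n + 1)
        rwa [pre, wordDist, if_pos h0.symm] at this
      have hg : gluing (tail u) (tail v) := by
        by_cases h1 : tail u 0 = tail v 0
        · exact ih ht hm h1
        · exact gluing_of_head_ne ht h1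
      have := gluing_cons (u 0) _ _ hg
      rwa [cons_head_tail, h0, cons_head_tail] at this
  · exact gluing_of_head_ne h h0

/-- The words of the cells that `wordDist w` does not separate from the cell of `w`, when all
letters of `w` except possibly the first lie on the outer side. -/
theorem exists_cover_of_side {w : Word} (hw : ∀ b ∈ w, side b = 0) (a : Letter) :
    ∃ L : Finset Word, L.card ≤ 6 ∧
      ∀ v, wordDist (a :: w) v < 1 → pre (w.length + 1) v ∈ L := by
  induction w generalizing a with
  | nil =>
    refine ⟨Finset.univ.image fun i => [i], Finset.card_image_le, fun v _ => ?_⟩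
    simp [pre]
  | cons b w ih =>
    obtain ⟨L, hL, hcov⟩ := ih (fun c hc => hw c (List.mem_cons_of_mem _ hc)) b
    refine ⟨L.image (List.cons a), Finset.card_image_le.trans hL, fun v hv => ?_⟩
    rw [wordDist] at hv
    split_ifs at hv with h
    · exact Finset.mem_image.2 ⟨_, hcov _ hv, by simp [pre, h]⟩
    -- Leaving the 1-cell `a` would require `b` to lie on a gluing side, `1` or `2`, but it lies on
    -- the outer side.
    · have := (pre_eq_of_mirrorDist_lt_one hv).2.1
      rw [hw b (by simp)] at this
      exact absurd this (join_ne_zero _ _)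

/-- Each cell has a bounded number of neighbouring cells of the same level. -/
theorem exists_cover (w : Word) :
    ∃ L : Finset Word, L.card ≤ 12 ∧
      ∀ v, wordDist w v < 1 → pre w.length v ∈ L := by
  induction w with
  | nil => exact ⟨{[]}, by simp, fun v _ => by simp [pre]⟩
  | cons a w ih =>
    by_cases hw : ∀ b ∈ w, side b = 0
    · obtain ⟨L, hL, h⟩ := exists_cover_of_side hw a
      exact ⟨L, by omega, h⟩
    obtain _ | ⟨k, w⟩ := w
    · simp at hw
    by_cases hw' : ∀ b ∈ w, side b = 0
    · obtain ⟨L, hL, hcov⟩ := exists_cover_of_side hw' k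
      -- At most 6 cells inside the 1-cell `a`, and at most 6 words obtained by changing the first
      -- letter; this is the source of the constant 12.
      refine ⟨L.image (List.cons a) ∪ Finset.univ.image fun i => i :: k :: w, ?_, ?_⟩
      · have h1 : (L.image (List.cons a)).card ≤ 6 := Finset.card_image_le.trans hL
        have h2 : (Finset.univ.image fun i : Letter => i :: k :: w).card ≤ 6 :=
          Finset.card_image_le
        exact (Finset.card_union_le _ _).trans (by omega)
      · intro v hv
        rw [wordDist] at hv
        split_ifs at hv with h
        · exact Finset.mem_union_left _
            (Finset.mem_image.2 ⟨_, hcov _ hv, by simp [pre, h]⟩)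
        · refine Finset.mem_union_right _ (Finset.mem_image.2 ⟨v 0, Finset.mem_univ _, ?_⟩)
          rw [List.length_cons, pre, List.length_cons, (pre_eq_of_mirrorDist_lt_one hv).1]
    -- A letter off the outer side after the second position keeps the cell away from the other
    -- 1-cells, so no new neighbours appear.
    · obtain ⟨L, hL, hcov⟩ := ih
      refine ⟨L.image (List.cons a), Finset.card_image_le.trans hL, fun v hv => ?_⟩
      rw [wordDist] at hv
      split_ifs at hv with h
      · exact Finset.mem_image.2 ⟨_, hcov _ hv, by simp [pre, h]⟩
      · exact absurd (pre_eq_of_mirrorDist_lt_one hv).2.2 hw'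

/-! ### The threshold 1/2 and the diameters of cells -/

section chainDist

variable {μ : ℝ}

/-- `μ ^ n * F` is an admissible test function: on cells of level at least `n` because `1/2 ≤ μ`, on
larger cells because `F` takes values in `[0, 1]`. -/
theorem pow_mul_abs_sub_le_chainDist (hμ : 1 / 2 ≤ μ) (hμ1 : μ < 1) (n : ℕ) {F : InfWord → ℝ}
    (hF : ∀ u v, Glue u v → F u = F v) (hF01 : ∀ v, F v ∈ Icc (0 : ℝ) 1)
    (hosc : ∀ w : Word, n ≤ w.length → ∀ u v,
      |F (append w u) - F (append w v)| ≤ (1 / 2) ^ (w.length - n)) (u v : InfWord) :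
    μ ^ n * |F u - F v| ≤ chainDist μ (proj u) (proj v) := by
  have hμ0 : 0 < μ := by linarith
  have key := abs_sub_le_chainDist (μ := μ)
    (F := Quotient.lift (fun v => μ ^ n * F v) fun u v h => by
      rw [eq_of_gluing hF h])
    (fun w x hx y hy => by
      obtain ⟨u, rfl⟩ := mem_cell.1 hx
      obtain ⟨v, rfl⟩ := mem_cell.1 hy
      change |μ ^ n * F (append w u) - μ ^ n * F (append w v)| ≤ _
      rw [← mul_sub, abs_mul, abs_of_pos (pow_pos hμ0 n)]
      rcases le_or_gt n w.length with h | h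
      · calc μ ^ n * |F (append w u) - F (append w v)|
            ≤ μ ^ n * μ ^ (w.length - n) := by
              gcongr
              exact (hosc w h u v).trans (by gcongr)
          _ = μ ^ w.length := by rw [← pow_add, Nat.add_sub_cancel' h]
      · calc μ ^ n * |F (append w u) - F (append w v)| ≤ μ ^ n * 1 := by
              gcongr
              simpa using abs_sub_le_of_le_of_le (hF01 (append w u)).1 (hF01 (append w u)).2
                (hF01 (append w v)).1 (hF01 (append w v)).2
          _ ≤ μ ^ w.length := by
              rw [mul_one]; exact pow_le_pow_of_le_one hμ0.le hμ1.le h.le)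
    (proj u) (proj v)
  change |μ ^ n * F u - μ ^ n * F v| ≤ _ at key
  rwa [← mul_sub, abs_mul, abs_of_pos (pow_pos hμ0 n)] at key

theorem wordDist_pre_lt_one (hμ : 1 / 2 ≤ μ) (hμ1 : μ < 1) {n : ℕ} {u v : InfWord}
    (h : chainDist μ (proj u) (proj v) < μ ^ n) : wordDist (pre n u) v < 1 := by
  have hpos : 0 < μ ^ n := pow_pos (by linarith) n
  have key := pow_mul_abs_sub_le_chainDist hμ hμ1 n (F := wordDist (pre n u))
    (fun u v h => wordDist_glue h _) (wordDist_mem_Icc _)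
    (fun w hw x y => by
      simpa using wordDist_append (w := pre n u) (u := w) (by simpa using hw) x y) u v
  rw [wordDist_pre, zero_sub, abs_neg, abs_of_nonneg (wordDist_mem_Icc _ _).1] at key
  nlinarith

theorem eq_of_chainDist_eq_zero (hμ : 1 / 2 ≤ μ) (hμ1 : μ < 1) {x y : Hexacarpet}
    (h : chainDist μ x y = 0) : x = y := by
  obtain ⟨u, rfl⟩ := proj_surjective x
  obtain ⟨v, rfl⟩ := proj_surjective y
  refine proj_eq_iff.2 (gluing_of_wordDist_lt_one fun n => wordDist_pre_lt_one hμ hμ1 ?_)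
  rw [h]
  exact pow_pos (by linarith) n

theorem isMetric_chainDist (hμ : 1 / 2 ≤ μ) (hμ1 : μ < 1) : IsMetric (chainDist μ) where
  nonneg := chainDist_nonneg (by linarith)
  self := chainDist_self (by linarith) hμ1
  symm := chainDist_comm (by linarith)
  triangle := chainDist_triangle (by linarith)
  eq_of_zero _ _ := eq_of_chainDist_eq_zero hμ hμ1

theorem onSide_zero_const : OnSide 0 fun _ => 0 := ⟨rfl, fun _ => rfl⟩

theorem onSide_one_cons : OnSide 1 (cons 1 fun _ => 0) := ⟨rfl, fun _ => rfl⟩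

/-- The two ends of the Gray code paths of cells with words in `{0, 1}ⁿ`. -/
theorem proj_zero_ne_proj_one : proj (fun _ => 0) ≠ proj (cons 1 fun _ => 0) := by
  intro h
  have := eq_of_gluing (fun u v h => sideDist_glue h (some 0)) (proj_eq_iff.1 h)
  rw [sideDist_of_onSide onSide_zero_const, sideDist_of_onSide onSide_one_cons] at this
  simp at this

/-- The distance to the side `0` is itself a test function (level 0), with values 0 and 1 at these
points. -/
theorem chainDist_zero_one (hμ : 1 / 2 ≤ μ) (hμ1 : μ < 1) :
    chainDist μ (proj fun _ => 0) (proj (cons 1 fun _ => 0)) = 1 := by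
  refine le_antisymm (chainDist_le_one (by linarith) _ _) ?_
  have key := pow_mul_abs_sub_le_chainDist hμ hμ1 0 (F := sideDist (some 0))
    (fun u v h => sideDist_glue h _) (fun v => ⟨sideDist_nonneg _ v, sideDist_le_one _ v⟩)
    (fun w _ x y => by simpa using sideDist_append w (some 0) x y)
    (fun _ => 0) (cons 1 fun _ => 0)
  rw [sideDist_of_onSide onSide_zero_const, sideDist_of_onSide onSide_one_cons] at key
  simpa using key

/-- Since `z = 0z` and `01z ∼ 11z`, the route from `z` to `1z` through `11z` consists of the images
of the pair under `f 0` and `f 1`, giving `d ≤ 2μ d` with `2μ < 1`. -/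
theorem chainDist_zero_one_eq_zero (hμ0 : 0 < μ) (hμ : μ < 1 / 2) :
    chainDist μ (proj fun _ => 0) (proj (cons 1 fun _ => 0)) = 0 := by
  have hμ1 : μ < 1 := by linarith
  set z : InfWord := fun _ => 0
  have hz : cons 0 z = z := by funext n; cases n <;> rfl
  have hglue : proj (cons 0 (cons 1 z)) = proj (cons 1 (cons 1 z)) :=
    proj_eq_of_glue (Glue.even [] 0 1 z (by decide) (.inl rfl) fun _ => .inl rfl)
  have h1 := chainDist_f hμ0 hμ1 0 (proj z) (proj (cons 1 z))
  have h2 := chainDist_f hμ0 hμ1 1 (proj (cons 1 z)) (proj z)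
  rw [f_proj, f_proj] at h1 h2
  rw [hz, hglue] at h1
  rw [chainDist_comm hμ0 (proj (cons 1 z)) (proj z)] at h2
  have h3 := chainDist_triangle hμ0 (proj z) (proj (cons 1 z)) (proj (cons 1 (cons 1 z)))
  have h4 := chainDist_nonneg hμ0 (proj z) (proj (cons 1 z))
  rw [h1, h2] at h3
  nlinarith

theorem isLUB_chainDist_cell (hμ : 1 / 2 ≤ μ) (hμ1 : μ < 1) (w : Word) :
    IsLUB {r : ℝ | ∃ x ∈ cell w, ∃ y ∈ cell w, r = chainDist μ x y} (μ ^ w.length) := by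
  refine IsGreatest.isLUB ⟨⟨_, ⟨proj fun _ => 0, rfl⟩, _, ⟨proj (cons 1 fun _ => 0), rfl⟩, ?_⟩, ?_⟩
  · rw [chainDist_fWord (by linarith) hμ1, chainDist_zero_one hμ hμ1, mul_one]
  · rintro _ ⟨x, hx, y, hy, rfl⟩
    exact chainDist_le_pow (by linarith) hx hy

end chainDist

/-! ### Hausdorff measure and dimension -/

theorem pre_eq_of_forall_lt {u v : InfWord} {n : ℕ} (h : ∀ m < n, u m = v m) :
    pre n u = pre n v := by
  induction n generalizing u v with
  | zero => rfl
  | succ n ih =>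
    simp only [pre, List.cons.injEq]
    exact ⟨h 0 (by omega), ih fun m hm => h (m + 1) (by omega)⟩

/-- The uniform Bernoulli measure on infinite words. -/
noncomputable def bernoulli : Measure InfWord :=
  Measure.infinitePi fun _ => (PMF.uniformOfFintype Letter).toMeasure

instance : IsProbabilityMeasure bernoulli := by unfold bernoulli; infer_instance

theorem bernoulli_cylinder_le (n : ℕ) (w : Word) : bernoulli {v | pre n v = w} ≤ 6⁻¹ ^ n := by
  rcases eq_empty_or_nonempty {v | pre n v = w} with h | ⟨u, rfl⟩
  · rw [h]; simp
  calc bernoulli {v | pre n v = pre n u}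
      ≤ bernoulli (Set.pi (Finset.range n) fun m => {u m}) := by
        refine measure_mono fun v hv m hm => ?_
        exact apply_eq_of_pre_eq (Finset.mem_range.1 (Finset.mem_coe.1 hm)) hv
    _ = 6⁻¹ ^ n := by
        rw [bernoulli, Measure.infinitePi_pi _ fun _ _ => measurableSet_singleton _]
        simp

theorem rpow_similarityDim {μ : ℝ} (hμ0 : 0 < μ) (hμ1 : μ < 1) (n : ℕ) :
    ENNReal.ofReal (μ ^ n) ^ (-Real.log 6 / Real.log μ) = 6⁻¹ ^ n := by
  have h : μ ^ (-Real.log 6 / Real.log μ) = 6⁻¹ := by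
    rw [Real.rpow_def_of_pos hμ0, mul_div_cancel₀ _ (Real.log_neg hμ0 hμ1).ne, Real.exp_neg,
      Real.exp_log (by norm_num)]
  rw [ENNReal.ofReal_pow hμ0.le, ← ENNReal.rpow_natCast, ← ENNReal.rpow_mul, mul_comm,
    ENNReal.rpow_mul, ENNReal.ofReal_rpow_of_pos hμ0, h, ENNReal.rpow_natCast,
    ENNReal.ofReal_inv_of_pos (by norm_num)]
  norm_num

theorem similarityDim_pos {μ : ℝ} (hμ0 : 0 < μ) (hμ1 : μ < 1) :
    0 < -Real.log 6 / Real.log μ :=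
  div_pos_of_neg_of_neg (neg_neg_of_pos (Real.log_pos (by norm_num))) (Real.log_neg hμ0 hμ1)

section Hausdorff

variable {X : Type*} [MetricSpace X] {μ : ℝ} {p : InfWord → X}

theorem continuous_of_dist_le_pow (hμ1 : μ < 1)
    (hdist : ∀ n u v, pre n u = pre n v → dist (p u) (p v) ≤ μ ^ n) : Continuous p := by
  refine continuous_iff_continuousAt.2 fun u => Metric.tendsto_nhds.2 fun ε hε => ?_
  obtain ⟨n, hn⟩ := exists_pow_lt_of_lt_one hε hμ1
  have : {v : InfWord | ∀ m ∈ Finset.range n, v m ∈ ({u m} : Set Letter)} ∈ nhds u :=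
    (isOpen_set_pi (Finset.finite_toSet _) fun _ _ => isOpen_discrete _).mem_nhds fun m _ => rfl
  filter_upwards [this] with v hv
  exact (hdist n v u (pre_eq_of_forall_lt fun m hm => hv m (Finset.mem_range.2 hm))).trans_lt hn

theorem bernoulli_preimage_le (hμ0 : 0 < μ) (hμ1 : μ < 1)
    (hcov : ∀ n u, ∃ L : Finset Word, L.card ≤ 12 ∧
      ∀ v, dist (p u) (p v) < μ ^ n → pre n v ∈ L) {s : Set X} {n : ℕ}
    (hs : Metric.ediam s ≤ ENNReal.ofReal (μ ^ n)) : bernoulli (p ⁻¹' s) ≤ 72 * 6⁻¹ ^ n := by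
  cases n with
  | zero => exact prob_le_one.trans (by norm_num)
  | succ n =>
    rcases eq_empty_or_nonempty (p ⁻¹' s) with h | ⟨u, hu⟩
    · rw [h]; simp
    -- The covering needs a strict inequality, so a set of diameter at most `μ ^ (n + 1)` is covered
    -- at level `n`; the lost level turns 12 into `72 = 12 * 6`.
    obtain ⟨L, hL, hcov⟩ := hcov n u
    calc bernoulli (p ⁻¹' s) ≤ bernoulli (⋃ w ∈ L, {v | pre n v = w}) := by
          refine measure_mono fun v hv => mem_iUnion₂.2 ⟨_, hcov v ?_, rfl⟩
          have h1 : edist (p u) (p v) ≤ ENNReal.ofReal (μ ^ (n + 1)) :=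
            (Metric.edist_le_ediam_of_mem (s := s) hu hv).trans hs
          rw [edist_dist, ENNReal.ofReal_le_ofReal_iff (by positivity)] at h1
          exact h1.trans_lt (pow_lt_pow_right_of_lt_one₀ hμ0 hμ1 (Nat.lt_succ_self n))
      _ ≤ ∑ w ∈ L, bernoulli {v | pre n v = w} := measure_biUnion_finset_le _ _
      _ ≤ ∑ w ∈ L, 6⁻¹ ^ n := Finset.sum_le_sum fun w _ => bernoulli_cylinder_le n w
      _ = L.card * 6⁻¹ ^ n := by rw [Finset.sum_const, nsmul_eq_mul]
      _ ≤ 12 * 6⁻¹ ^ n := by gcongr; exact_mod_cast hL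
      _ = 72 * 6⁻¹ ^ (n + 1) := by
          have : (72 : ℝ≥0∞) * 6⁻¹ = 12 := by
            rw [show (72 : ℝ≥0∞) = 12 * 6 by norm_num, mul_assoc,
              ENNReal.mul_inv_cancel (by norm_num) (by norm_num), mul_one]
          rw [pow_succ', ← mul_assoc, this]

variable [MeasurableSpace X] [BorelSpace X]

/-- Each of the `6 ^ n` cylinder images contributes at most `(μ ^ n) ^ α = 6⁻¹ ^ n`, so every level
gives a sum at most 1. -/
theorem hausdorffMeasure_univ_lt_top (hμ0 : 0 < μ) (hμ1 : μ < 1) (hp : Function.Surjective p)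
    (hdist : ∀ n u v, pre n u = pre n v → dist (p u) (p v) ≤ μ ^ n) :
    Measure.hausdorffMeasure (-Real.log 6 / Real.log μ) (univ : Set X) < ⊤ := by
  have hdiam : ∀ n (i : Fin n → Letter),
      Metric.ediam (p '' {v | ∀ m : Fin n, v m = i m}) ≤ ENNReal.ofReal (μ ^ n) := by
    intro n i
    refine Metric.ediam_le ?_
    rintro _ ⟨u, hu, rfl⟩ _ ⟨v, hv, rfl⟩
    rw [edist_dist]
    refine ENNReal.ofReal_le_ofReal (hdist n u v (pre_eq_of_forall_lt fun m hm => ?_))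
    exact (hu ⟨m, hm⟩).trans (hv ⟨m, hm⟩).symm
  have hlim : Filter.Tendsto (fun n => ENNReal.ofReal (μ ^ n)) Filter.atTop (nhds 0) := by
    simpa using ENNReal.tendsto_ofReal (tendsto_pow_atTop_nhds_zero_of_lt_one hμ0.le hμ1)
  refine (Measure.hausdorffMeasure_le_liminf_sum (-Real.log 6 / Real.log μ) univ _ hlim
    (fun n (i : Fin n → Letter) => p '' {v | ∀ m : Fin n, v m = i m})
    (.of_forall hdiam) (.of_forall fun n x _ => ?_)).trans_lt ?_
  · obtain ⟨v, rfl⟩ := hp x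
    exact mem_iUnion.2 ⟨fun m => v m, v, fun _ => rfl, rfl⟩
  · refine lt_of_le_of_lt (b := 1) ?_ ENNReal.one_lt_top
    refine (Filter.liminf_le_liminf (v := fun _ => 1) (.of_forall fun n => ?_)).trans_eq
      (Filter.liminf_const _)
    calc ∑ i : Fin n → Letter, Metric.ediam (p '' {v | ∀ m : Fin n, v m = i m}) ^
            (-Real.log 6 / Real.log μ)
        ≤ ∑ i : Fin n → Letter, 6⁻¹ ^ n := by
          refine Finset.sum_le_sum fun i _ => ?_
          rw [← rpow_similarityDim hμ0 hμ1 n]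
          exact ENNReal.rpow_le_rpow (hdiam n i) (similarityDim_pos hμ0 hμ1).le
      _ = 1 := by
          simp only [Finset.sum_const, Finset.card_univ, Fintype.card_pi, Fintype.card_fin,
            Finset.prod_const, nsmul_eq_mul, Nat.cast_pow, Nat.cast_ofNat]
          rw [← mul_pow, ENNReal.mul_inv_cancel (by norm_num) (by norm_num), one_pow]

theorem hausdorffMeasure_univ_pos (hμ0 : 0 < μ) (hμ1 : μ < 1)
    (hdist : ∀ n u v, pre n u = pre n v → dist (p u) (p v) ≤ μ ^ n)
    (hcov : ∀ n u, ∃ L : Finset Word, L.card ≤ 12 ∧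
      ∀ v, dist (p u) (p v) < μ ^ n → pre n v ∈ L) :
    0 < Measure.hausdorffMeasure (-Real.log 6 / Real.log μ) (univ : Set X) := by
  have hα := similarityDim_pos hμ0 hμ1
  have hmeas : Measurable p := (continuous_of_dist_le_pow hμ1 hdist).measurable
  -- Mass distribution principle. Bracketing a diameter between `μ ^ (n + 1)` and `μ ^ n` costs one
  -- more factor 6, and `432 = 72 * 6`.
  have key : (432 : ℝ≥0∞)⁻¹ • bernoulli.map p ≤
      Measure.hausdorffMeasure (-Real.log 6 / Real.log μ) := by
    refine Measure.le_hausdorffMeasure _ _ 1 one_pos fun s hs => ?_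
    rw [Measure.smul_apply, smul_eq_mul, ENNReal.inv_mul_le_iff (by norm_num) (by norm_num)]
    -- The closure has the same diameter and is measurable.
    refine (measure_mono (subset_closure (s := s))).trans ?_
    rw [← Metric.ediam_closure s] at hs ⊢
    rw [Measure.map_apply hmeas isClosed_closure.measurableSet]
    generalize closure s = s at hs ⊢
    have htop : Metric.ediam s ≠ ⊤ := ne_top_of_le_ne_top ENNReal.one_ne_top hs
    rcases eq_or_ne (Metric.ediam s) 0 with h0 | h0
    -- Diameter 0 cannot be bracketed by powers of `μ`; the bound `72 * 6⁻¹ ^ n` for every `n` shows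
    -- that such a set is null.
    · refine le_of_eq_of_le ?_ zero_le
      have hlim : Filter.Tendsto (fun n : ℕ => (72 : ℝ≥0∞) * 6⁻¹ ^ n) Filter.atTop (nhds 0) := by
        have := ENNReal.Tendsto.const_mul (a := 72) (ENNReal.tendsto_pow_atTop_nhds_zero_of_lt_one
          (r := (6 : ℝ≥0∞)⁻¹) (ENNReal.inv_lt_one.2 (by norm_num))) (.inr (by norm_num))
        simpa using this
      refine le_antisymm (ge_of_tendsto' hlim fun n => ?_) zero_le
      exact bernoulli_preimage_le hμ0 hμ1 hcov (by rw [h0]; exact zero_le)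
    · obtain ⟨n, hn, hn'⟩ := exists_nat_pow_near_of_lt_one
        (ENNReal.toReal_pos h0 htop) (ENNReal.toReal_le_of_le_ofReal zero_le_one (by simpa using hs))
        hμ0 hμ1
      refine (bernoulli_preimage_le hμ0 hμ1 hcov
        ((ENNReal.le_ofReal_iff_toReal_le htop (by positivity)).2 hn')).trans ?_
      calc (72 : ℝ≥0∞) * 6⁻¹ ^ n = 432 * 6⁻¹ ^ (n + 1) := by
            have : (432 : ℝ≥0∞) * 6⁻¹ = 72 := by
              rw [show (432 : ℝ≥0∞) = 72 * 6 by norm_num, mul_assoc,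
                ENNReal.mul_inv_cancel (by norm_num) (by norm_num), mul_one]
            rw [pow_succ', ← mul_assoc, this]
        _ ≤ 432 * Metric.ediam s ^ (-Real.log 6 / Real.log μ) := by
            rw [← rpow_similarityDim hμ0 hμ1]
            gcongr
            exact (ENNReal.ofReal_le_iff_le_toReal htop).2 hn.le
  refine lt_of_lt_of_le ?_ (key univ)
  rw [Measure.smul_apply, Measure.map_apply hmeas MeasurableSet.univ, preimage_univ, measure_univ]
  simp

end Hausdorff

/-- Stated for a bare type, so that the topology of `d` is the only one present; `Hexacarpet`
already carries the quotient topology as an instance. -/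
theorem IsMetric.hausdorff_similarityDim {X : Type*} {d : X → X → ℝ} (h : IsMetric d) {μ : ℝ}
    (hμ0 : 0 < μ) (hμ1 : μ < 1) {p : InfWord → X} (hp : Function.Surjective p)
    (hdist : ∀ n u v, pre n u = pre n v → d (p u) (p v) ≤ μ ^ n)
    (hcov : ∀ n u, ∃ L : Finset Word, L.card ≤ 12 ∧ ∀ v, d (p u) (p v) < μ ^ n → pre n v ∈ L) :
    h.hausdorffDim = ENNReal.ofReal (-Real.log 6 / Real.log μ) ∧
      0 < h.hausdorffMeasure (-Real.log 6 / Real.log μ) univ ∧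
      h.hausdorffMeasure (-Real.log 6 / Real.log μ) univ < ⊤ := by
  let : MetricSpace X := h.toMetricSpace
  let : MeasurableSpace X := h.borel
  have : BorelSpace X := ⟨rfl⟩
  have hpos := hausdorffMeasure_univ_pos (p := p) hμ0 hμ1 hdist hcov
  have hlt := hausdorffMeasure_univ_lt_top hμ0 hμ1 hp hdist
  refine ⟨?_, hpos, hlt⟩
  have hα := Real.coe_toNNReal _ (similarityDim_pos hμ0 hμ1).le
  exact dimH_of_hausdorffMeasure_ne_zero_ne_top (s := (univ : Set X))
    (by rw [hα]; exact hpos.ne') (by rw [hα]; exact hlt.ne)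

theorem hausdorff_chainDist {μ : ℝ} (hμ : 1 / 2 ≤ μ) (hμ1 : μ < 1)
    (h : IsMetric (chainDist μ)) :
    h.hausdorffDim = ENNReal.ofReal (-Real.log 6 / Real.log μ) ∧
      0 < h.hausdorffMeasure (-Real.log 6 / Real.log μ) univ ∧
      h.hausdorffMeasure (-Real.log 6 / Real.log μ) univ < ⊤ := by
  have hμ0 : 0 < μ := by linarith
  refine h.hausdorff_similarityDim hμ0 hμ1 proj_surjective (fun n u v huv => ?_) fun n u => ?_
  · have := chainDist_le_pow hμ0 (proj_mem_cell_pre n u) (huv ▸ proj_mem_cell_pre n v)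
    rwa [length_pre] at this
  · obtain ⟨L, hL, hcov⟩ := exists_cover (pre n u)
    refine ⟨L, hL, fun v hv => ?_⟩
    simpa using hcov v (wordDist_pre_lt_one hμ hμ1 hv)

theorem isProbabilityMeasure_normalizedHausdorffMeasure {X : Type*} {d : X → X → ℝ}
    (h : IsMetric d) {α : ℝ} (h0 : 0 < h.hausdorffMeasure α univ)
    (htop : h.hausdorffMeasure α univ < ⊤) :
    @IsProbabilityMeasure X h.borel (h.normalizedHausdorffMeasure α) := by
  let : MeasurableSpace X := h.borel
  refine ⟨?_⟩
  rw [IsMetric.normalizedHausdorffMeasure, Measure.smul_apply, smul_eq_mul,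
    ENNReal.inv_mul_cancel h0.ne' htop.ne]

end Strichartz

theorem theorem2p1 (μ : ℝ) (hμ0 : 0 < μ) (hμ1 : μ < 1) :
    (Strichartz.IsMetric (Strichartz.chainDist μ) ↔ μ ∈ Set.Ico (1 / 2 : ℝ) 1) ∧
    (μ ∈ Set.Ico (1 / 2 : ℝ) 1 →
      (∀ (i : Strichartz.Letter) (x y : Strichartz.Hexacarpet),
        Strichartz.chainDist μ (Strichartz.f i x) (Strichartz.f i y) =
          μ * Strichartz.chainDist μ x y) ∧
      (∀ w : Strichartz.Word,
        IsLUB {r : ℝ | ∃ x ∈ Strichartz.cell w, ∃ y ∈ Strichartz.cell w,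
          r = Strichartz.chainDist μ x y} (μ ^ w.length)) ∧
      ∃ h : Strichartz.IsMetric (Strichartz.chainDist μ),
        h.hausdorffDim = ENNReal.ofReal (-Real.log 6 / Real.log μ) ∧
        0 < h.hausdorffMeasure (-Real.log 6 / Real.log μ) Set.univ ∧
        h.hausdorffMeasure (-Real.log 6 / Real.log μ) Set.univ < ⊤ ∧
        @MeasureTheory.IsProbabilityMeasure Strichartz.Hexacarpet h.borel
          (h.normalizedHausdorffMeasure (-Real.log 6 / Real.log μ))) := by

  open Strichartz in
  refine ⟨⟨fun h => ⟨?_, hμ1⟩, fun h => isMetric_chainDist h.1 h.2⟩, fun h =>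
    ⟨chainDist_f hμ0 hμ1, isLUB_chainDist_cell h.1 h.2, isMetric_chainDist h.1 h.2, ?_⟩⟩
  · by_contra hlt
    exact proj_zero_ne_proj_one
      (h.eq_of_zero _ _ (chainDist_zero_one_eq_zero hμ0 (not_le.1 hlt)))
  · obtain ⟨h1, h2, h3⟩ := hausdorff_chainDist h.1 h.2 (isMetric_chainDist h.1 h.2)
    exact ⟨h1, h2, h3, isProbabilityMeasure_normalizedHausdorffMeasure _ h2 h3⟩
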